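/- For a graph $H$ and a function $p = p(n) \in [0,1]$, let $G(n,p)$ denote the binomial random graph on $n$ labelled vertices in which each pair of vertices is an edge independently with probability $p(n)$, and define the chromatic threshold of $H$ with respect to $p$ by $$\delta_\chi(H,p) := \inf\Big\{ d > 0 \,:\, \text{there exists } C > 0 \text{ such that, with probability tending to } 1 \text{ as } n \to \infty, \text{ every } H\text{-free spanning subgraph } G \subset G(n,p) \text{ with minimum degree } \delta(G) \ge d\,p\,n \text{ satisfies } \chi(G) \le C \Big\},$$ where $C$ may depend on $H$, $p$ and $d$ but not on $n$, where $H$-free means containing no (not necessarily induced) copy of $H$, and where the infimum of the empty set is $+\infty$. Let $C_5$ be the cycle of length $5$. Then for every function $p = p(n) \in [0,1]$ such that $n^{-1/2} = o(p(n))$ and $p(n) = o(1)$ as $n \to \infty$, $$\delta_\chi(C_5,p) \le \tfrac13.$$ -/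

import Mathlib

open Filter Topology Asymptotics

namespace SimpleGraph

/-- The sequence of graph properties `P n` holds with high probability in the binomial random graph
on `n` labelled vertices with edge probability `p n`: its probability tends to `1`. -/
def WithHighProb (p : ℕ → unitInterval) (P : ∀ n : ℕ, SimpleGraph (Fin n) → Prop) : Prop :=
  Tendsto (fun n : ℕ => binomialRandom (Fin n) (p n) {Γ | P n Γ}) atTop (𝓝 1)

open scoped Classical in
/-- The graph `Γ` on `n` vertices is such that every `H`-free spanning subgraph `G` of `Γ` with
minimum degree at least `d * q * n` has chromatic number at most `C`. A spanning subgraph of `Γ`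
is a graph on the same vertex set below `Γ`. -/
def BoundsChromatic {W : Type*} (H : SimpleGraph W) (d q : ℝ) (C : ℕ) (n : ℕ)
    (Γ : SimpleGraph (Fin n)) : Prop :=
  ∀ G : SimpleGraph (Fin n), G ≤ Γ → H.Free G → d * q * (n : ℝ) ≤ (G.minDegree : ℝ) →
    G.chromaticNumber ≤ (C : ℕ∞)

/-- The chromatic threshold of `H` with respect to `p`. The infimum is taken in the extended reals,
so that it would be `⊤` if no `d` were admissible. -/
noncomputable def chromaticThreshold {W : Type*} (H : SimpleGraph W) (p : ℕ → unitInterval) :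
    EReal :=
  sInf ((fun d : ℝ => (d : EReal)) ''
    {d : ℝ | 0 < d ∧ ∃ C : ℕ, 0 < C ∧
      WithHighProb p (fun n Γ => BoundsChromatic H d (p n : ℝ) C n Γ)})

end SimpleGraph

/-! Fix `η > 0` and let `G ⊆ Γ` be pentagon-free with minimum degree at least `(1/3 + η) q N`, where
`N` is the number of vertices and `Γ` is random of density `q`. Let `D v` be the set of `w ≠ v`
having at least three common neighbours with `v`. Since `q² N → ∞`, the vertices outside `D v`
absorb few edges from the neighbourhood of `v`, so uniformity of `Γ` forces `|D v|` above `N / 3`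
(`le_card_sndNbhd`). Pentagon-freeness makes each `D v` independent, and `D u`, `D v` disjoint when
`u` and `v` are adjacent. Two such sets cover more than `2N/3` vertices. The complement is too small
to receive all their edges, so order `q N²` edges run between them (`le_edgeCount_of_indep`).

To turn this into a colouring, weak regularity relative to `Γ` (`exists_cut_approximation`)
approximates all edge counts of `G` by boundedly many weighted rectangles `S t × T t`. Colour `v` by
the rounded sizes `|D v ∩ S t|`. Adjacent `u`, `v` of one colour would give `e(D u, D v) ≈ e(D v, D
v) = 0`, a contradiction (`colorable_of_edgeCount`). The only random input is edge-uniformity, a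
Chernoff bound with a union bound over pairs of sets. -/

namespace SimpleGraph

/-- The linear combination, with coefficients `ε * s t`, of the indicators of the sets `R t` for
`t < k`. -/
noncomputable def indicatorComb {X : Type*} [DecidableEq X] (ε : ℝ) (R : ℕ → Finset X) (s : ℕ → ℝ)
    (k : ℕ) (x : X) : ℝ :=
  ε * ∑ t ∈ Finset.range k, s t * if x ∈ R t then 1 else 0

/-! ### Weak regularity by energy decrement -/

section CutApproximation

variable {X : Type*} [DecidableEq X]

lemma sum_indicatorComb (ε : ℝ) (R : ℕ → Finset X) (s : ℕ → ℝ) (k : ℕ) (A : Finset X) :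
    ∑ x ∈ A, indicatorComb ε R s k x =
      ε * ∑ t ∈ Finset.range k, s t * ((A ∩ R t).card : ℝ) := by
  simp only [indicatorComb]
  rw [← Finset.mul_sum, Finset.sum_comm]
  congr 1
  refine Finset.sum_congr rfl fun t _ => ?_
  rw [← Finset.mul_sum, Finset.sum_boole, Finset.filter_mem_eq_inter]

variable [Fintype X]

/-- Squaring produces only indicators of pairwise intersections, so control of `g` on an
intersection-closed family controls its integral against the square. -/
lemma sum_mul_indicatorComb_sq (g : X → ℝ) (ε : ℝ) (R : ℕ → Finset X) (s : ℕ → ℝ) (k : ℕ) :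
    ∑ x, g x * indicatorComb ε R s k x ^ 2 =
      ε ^ 2 * ∑ t ∈ Finset.range k, ∑ u ∈ Finset.range k, s t * s u * ∑ x ∈ R t ∩ R u, g x := by
  have h : ∀ x, g x * indicatorComb ε R s k x ^ 2 = ε ^ 2 * ∑ t ∈ Finset.range k,
      ∑ u ∈ Finset.range k, s t * s u * if x ∈ R t ∩ R u then g x else 0 := by
    intro x
    rw [indicatorComb, mul_pow, sq (∑ t ∈ Finset.range k, _), Finset.sum_mul_sum, mul_left_comm,
      Finset.mul_sum]
    congr 1
    refine Finset.sum_congr rfl fun t _ => ?_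
    rw [Finset.mul_sum]
    refine Finset.sum_congr rfl fun u _ => ?_
    by_cases h1 : x ∈ R t <;> by_cases h2 : x ∈ R u <;> simp [h1, h2]
    ring
  simp only [h]
  rw [← Finset.mul_sum, Finset.sum_comm]
  congr 1
  refine Finset.sum_congr rfl fun t _ => ?_
  rw [Finset.sum_comm]
  refine Finset.sum_congr rfl fun u _ => ?_
  rw [← Finset.mul_sum]
  congr 1
  rw [Finset.sum_ite_mem, Finset.univ_inter]

/-- If `0 ≤ f ≤ g` and `g` has density close to `p` on every member of an intersection-closed
family, the energy of `indicatorComb` relative to `f` is bounded from below. -/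
lemma energy_lower_bound {f g : X → ℝ} {p ε δ : ℝ} {F : Set (Finset X)}
    (hf : ∀ x, 0 ≤ f x) (hfg : ∀ x, f x ≤ g x)
    (hF : ∀ A ∈ F, ∀ B ∈ F, A ∩ B ∈ F) (huniv : Finset.univ ∈ F)
    (hg : ∀ A ∈ F, |∑ x ∈ A, g x - p * A.card| ≤ δ * (p * Fintype.card X))
    {R : ℕ → Finset X} {s : ℕ → ℝ} {k : ℕ} (hR : ∀ t < k, R t ∈ F) (hs : ∀ t < k, |s t| ≤ 1) :
    -((1 + δ + ε ^ 2 * k ^ 2 * δ) * (p * Fintype.card X)) ≤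
      p * ∑ x, indicatorComb ε R s k x ^ 2 - 2 * ∑ x, f x * indicatorComb ε R s k x := by
  set h := indicatorComb ε R s k with hh
  set K := δ * (p * (Fintype.card X : ℝ)) with hK
  -- AM-GM, `2h ≤ 1 + h²`, weighted by `f` and then enlarged to the majorant `g`. Next, `g` is
  -- replaced by `p` in both resulting terms.
  have h1 : 2 * ∑ x, f x * h x ≤ ∑ x, g x + ∑ x, g x * h x ^ 2 := by
    rw [Finset.mul_sum, ← Finset.sum_add_distrib]
    refine Finset.sum_le_sum fun x _ => ?_
    have h2 : 2 * h x ≤ 1 + h x ^ 2 := by nlinarith [sq_nonneg (h x - 1)]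
    have h3 : 0 ≤ 1 + h x ^ 2 := by positivity
    nlinarith [mul_le_mul_of_nonneg_left h2 (hf x), mul_le_mul_of_nonneg_right (hfg x) h3]
  have h2 : ∑ x, g x ≤ p * Fintype.card X + K := by
    have := (abs_le.1 (hg _ huniv)).2
    rw [Finset.card_univ] at this
    linarith
  have h3 : ∑ x, g x * h x ^ 2 - p * ∑ x, h x ^ 2 ≤ ε ^ 2 * (k ^ 2 * K) := by
    have e1 := sum_mul_indicatorComb_sq g ε R s k
    have e2 := sum_mul_indicatorComb_sq (fun _ => p) ε R s k
    rw [Finset.mul_sum, e1, e2, ← mul_sub, ← Finset.sum_sub_distrib]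
    refine mul_le_mul_of_nonneg_left ?_ (sq_nonneg ε)
    calc ∑ t ∈ Finset.range k, _ ≤ ∑ t ∈ Finset.range k, (k : ℝ) * K := by
          refine Finset.sum_le_sum fun t ht => ?_
          rw [← Finset.sum_sub_distrib]
          calc _ ≤ ∑ u ∈ Finset.range k, K := by
                refine Finset.sum_le_sum fun u hu => ?_
                rw [Finset.mem_range] at ht hu
                have hm := hg _ (hF _ (hR t ht) _ (hR u hu))
                rw [← mul_sub, Finset.sum_const, nsmul_eq_mul, mul_comm _ p]
                refine (le_abs_self _).trans ?_
                rw [abs_mul, abs_mul]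
                have : |s t| * |s u| ≤ 1 := mul_le_one₀ (hs t ht) (abs_nonneg _) (hs u hu)
                calc _ ≤ 1 * |∑ x ∈ R t ∩ R u, g x - p * (R t ∩ R u).card| :=
                      mul_le_mul_of_nonneg_right this (abs_nonneg _)
                  _ ≤ K := by rw [one_mul]; exact hm
            _ = k * K := by simp
      _ = k ^ 2 * K := by simp; ring
  have : (1 + δ + ε ^ 2 * k ^ 2 * δ) * (p * Fintype.card X) =
    p * Fintype.card X + K + ε ^ 2 * (k ^ 2 * K) := by rw [hK]; ring
  linarith

/-- Adding to `indicatorComb` a multiple of the indicator of a set on which it approximates `f`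
badly decreases the energy. -/
lemma exists_energy_decrement {f : X → ℝ} {p ε : ℝ} (hp : 0 ≤ p) (hε : 0 < ε)
    {R : ℕ → Finset X} {s : ℕ → ℝ} {k : ℕ} {A : Finset X}
    (hA : ε * (p * Fintype.card X) <
      |∑ x ∈ A, f x - p * (ε * ∑ t ∈ Finset.range k, s t * ((A ∩ R t).card : ℝ))|) :
    ∃ σ : ℝ, |σ| ≤ 1 ∧
      p * ∑ x, (indicatorComb ε R s k x + ε * σ * if x ∈ A then 1 else 0) ^ 2 -
        2 * ∑ x, f x * (indicatorComb ε R s k x + ε * σ * if x ∈ A then 1 else 0) ≤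
      p * ∑ x, indicatorComb ε R s k x ^ 2 - 2 * ∑ x, f x * indicatorComb ε R s k x
        - ε ^ 2 * (p * Fintype.card X) := by
  rw [← sum_indicatorComb] at hA
  set h := indicatorComb ε R s k with hh
  set D := ∑ x ∈ A, f x - p * ∑ x ∈ A, h x with hD
  -- `σ` is the sign of the discrepancy `D`. The linear term gains `2ε|D|`, more than twice `ε² p
  -- |X|`, and the quadratic term costs at most `ε² p |X|`.
  obtain ⟨σ, hσ, hσD⟩ : ∃ σ : ℝ, σ ^ 2 = 1 ∧ σ * D = |D| := by
    rcases le_total 0 D with h0 | h0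
    · exact ⟨1, by norm_num, by rw [abs_of_nonneg h0, one_mul]⟩
    · exact ⟨-1, by norm_num, by rw [abs_of_nonpos h0]; ring⟩
  refine ⟨σ, (abs_le_one_iff_mul_self_le_one.2 (by rw [← sq, hσ])), ?_⟩
  have e1 : ∑ x, (h x + ε * σ * if x ∈ A then 1 else 0) ^ 2 =
      ∑ x, h x ^ 2 + 2 * ε * σ * ∑ x ∈ A, h x + ε ^ 2 * A.card := by
    have : ∀ x, (h x + ε * σ * if x ∈ A then 1 else 0) ^ 2 =
        h x ^ 2 + 2 * ε * σ * (if x ∈ A then h x else 0) + ε ^ 2 * (if x ∈ A then 1 else 0) := by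
      intro x
      by_cases hx : x ∈ A
      · simp only [hx, if_true]; linear_combination ε ^ 2 * hσ
      · simp [hx]
    simp only [this, Finset.sum_add_distrib, ← Finset.mul_sum, Finset.sum_ite_mem,
      Finset.univ_inter, Finset.sum_const, nsmul_eq_mul, mul_one]
  have e2 : ∑ x, f x * (h x + ε * σ * if x ∈ A then 1 else 0) =
      ∑ x, f x * h x + ε * σ * ∑ x ∈ A, f x := by
    have : ∀ x, f x * (h x + ε * σ * if x ∈ A then 1 else 0) =
        f x * h x + ε * σ * (if x ∈ A then f x else 0) := by
      intro x
      by_cases hx : x ∈ A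
      · simp only [hx, if_true]; ring
      · simp [hx]
    simp only [this, Finset.sum_add_distrib, ← Finset.mul_sum, Finset.sum_ite_mem,
      Finset.univ_inter]
  rw [e1, e2]
  have hcard : (A.card : ℝ) ≤ Fintype.card X := by exact_mod_cast Finset.card_le_univ A
  have h4 : ε * σ * ∑ x ∈ A, f x - p * (ε * σ * ∑ x ∈ A, h x) = ε * |D| := by
    rw [← hσD, hD]; ring
  have h5 : ε ^ 2 * (p * A.card) ≤ ε ^ 2 * (p * Fintype.card X) := by gcongr
  have h6 : ε * (ε * (p * Fintype.card X)) ≤ ε * |D| := by gcongr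
  nlinarith

/-- Weak regularity relative to a sparse majorant: a function lying below a majorant of density
close to `p` on an intersection-closed family is approximated on that family by a linear
combination of boundedly many indicators of its members. -/
theorem exists_cut_approximation {f g : X → ℝ} {p ε δ : ℝ} {F : Set (Finset X)} {M : ℕ}
    (hp : 0 < p) (hε : 0 < ε) (hX : 0 < Fintype.card X)
    (hM : 1 + δ + ε ^ 2 * M ^ 2 * δ < M * ε ^ 2)
    (hf : ∀ x, 0 ≤ f x) (hfg : ∀ x, f x ≤ g x)
    (hF : ∀ A ∈ F, ∀ B ∈ F, A ∩ B ∈ F) (huniv : Finset.univ ∈ F)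
    (hg : ∀ A ∈ F, |∑ x ∈ A, g x - p * A.card| ≤ δ * (p * Fintype.card X)) :
    ∃ k ≤ M, ∃ R : ℕ → Finset X, ∃ s : ℕ → ℝ, (∀ t < k, R t ∈ F) ∧ (∀ t < k, |s t| ≤ 1) ∧
      ∀ A ∈ F, |∑ x ∈ A, f x - p * (ε * ∑ t ∈ Finset.range k, s t * ((A ∩ R t).card : ℝ))| ≤
        ε * (p * Fintype.card X) := by
  by_contra! hcon
  -- If no approximation exists, each step lowers the energy by `ε² p |X|`, starting from `0`. After
  -- `M` steps this violates the lower bound, by `hM`.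
  have key : ∀ k ≤ M, ∃ R : ℕ → Finset X, ∃ s : ℕ → ℝ, (∀ t < k, R t ∈ F) ∧
      (∀ t < k, |s t| ≤ 1) ∧
      p * ∑ x, indicatorComb ε R s k x ^ 2 - 2 * ∑ x, f x * indicatorComb ε R s k x ≤
        -(k * ε ^ 2 * (p * Fintype.card X)) := by
    intro k
    induction k with
    | zero => exact fun _ => ⟨fun _ => ∅, 0, by simp, by simp, by simp [indicatorComb]⟩
    | succ k ih =>
      intro hk
      obtain ⟨R, s, hR, hs, hE⟩ := ih (by omega)
      obtain ⟨A, hAF, hA⟩ := hcon k (by omega) R s hR hs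
      obtain ⟨σ, hσ, hdec⟩ := exists_energy_decrement hp.le hε hA
      refine ⟨Function.update R k A, Function.update s k σ, ?_, ?_, ?_⟩
      · intro t ht
        rcases eq_or_ne t k with rfl | h
        · simpa using hAF
        · simpa [h] using hR t (by omega)
      · intro t ht
        rcases eq_or_ne t k with rfl | h
        · simpa using hσ
        · simpa [h] using hs t (by omega)
      · have hstep : indicatorComb ε (Function.update R k A) (Function.update s k σ) (k + 1) =
            fun x => indicatorComb ε R s k x + ε * σ * if x ∈ A then 1 else 0 := by
          funext x
          simp only [indicatorComb]
          rw [Finset.sum_range_succ, mul_add, Function.update_self, Function.update_self, mul_assoc]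
          congr 2
          refine Finset.sum_congr rfl fun t ht => ?_
          have : t ≠ k := (Finset.mem_range.1 ht).ne
          simp [this]
        rw [hstep]
        refine hdec.trans ?_
        push_cast
        linarith
  obtain ⟨R, s, hR, hs, hE⟩ := key M le_rfl
  have hlow := energy_lower_bound (ε := ε) hf hfg hF huniv hg hR hs
  have hpos : 0 < p * (Fintype.card X : ℝ) := by positivity
  have := mul_lt_mul_of_pos_right hM hpos
  linarith

end CutApproximation

open scoped Classical in
/-- The indicator of adjacency in `G`, as a function on ordered pairs of vertices. -/
noncomputable def adjWeight {V : Type*} (G : SimpleGraph V) (z : V × V) : ℝ :=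
  if G.Adj z.1 z.2 then 1 else 0

/-- The number of ordered pairs in `A × B` that are adjacent in `G`. -/
noncomputable def edgeCount {V : Type*} (G : SimpleGraph V) (A B : Finset V) : ℝ :=
  ∑ z ∈ A ×ˢ B, adjWeight G z

/-! ### Concentration of edge counts in the random graph -/

section RandomGraph

open MeasureTheory ProbabilityTheory

variable {V : Type*}

/-- On finitely many vertices this makes every event and every function of the graph measurable. -/
instance [Countable V] : MeasurableSingletonClass (SimpleGraph V) where
  measurableSet_singleton G := by
    have h : ({G} : Set (SimpleGraph V)) = {H | ∀ u v, H.Adj u v ↔ G.Adj u v} := by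
      ext H
      simp only [Set.mem_singleton_iff, Set.mem_ofPred_eq]
      exact ⟨fun h => by simp [h], fun h => by ext u v; exact h u v⟩
    rw [h, ← measurable_mem]
    refine .forall fun u => .forall fun v => ?_
    refine Measurable.iff ?_ measurable_const
    have := measurable_iff_adj.1 (measurable_id (α := SimpleGraph V)) u v
    exact this

variable [DecidableEq V]

/-- The number of ordered pairs in `A × B` whose underlying unordered pair is `e`. -/
noncomputable def pairMult (A B : Finset V) (e : Sym2 V) : ℝ :=
  ((A ×ˢ B).filter fun z => s(z.1, z.2) = e).card

lemma pairMult_nonneg (A B : Finset V) (e : Sym2 V) : 0 ≤ pairMult A B e := Nat.cast_nonneg _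

lemma pairMult_le_two (A B : Finset V) (e : Sym2 V) : pairMult A B e ≤ 2 := by
  induction e using Sym2.ind with
  | _ x y =>
    have : ((A ×ˢ B).filter fun z => s(z.1, z.2) = s(x, y)) ⊆ {(x, y), (y, x)} := by
      intro z hz
      have := (Finset.mem_filter.1 hz).2
      rcases Sym2.eq_iff.1 this with h | h <;> simp [Prod.ext_iff, h.1, h.2]
    have h := (Finset.card_le_card this).trans Finset.card_le_two
    rw [pairMult]
    exact_mod_cast h

variable [Fintype V]

open scoped Classical in
/-- The exponential moment of a weighted edge count in the binomial random graph. -/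
lemma integral_exp_sum_edgeWeight (p : unitInterval) (w : Sym2 V → ℝ) :
    ∫ G, Real.exp (∑ e, G.edgeSet.indicator w e) ∂(binomialRandom V p) =
      ∏ e : Sym2 V, if e.IsDiag then 1 else (1 - p + p * Real.exp (w e)) := by
  rw [binomialRandom_eq_map, integral_map (by fun_prop)
      (measurable_of_finite _).aestronglyMeasurable,
    setBernoulli_eq_map, integral_map (show Measurable (fun q : Sym2 V → Prop => {i | q i}) from
      MeasurableEquiv.setOfPred.measurable).aemeasurable
      (measurable_of_finite _).aestronglyMeasurable,
    -- The integral is now over independent coordinates, one per unordered pair, with diagonal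
    -- coordinates always false; the exponential of a sum factors.
    Measure.infinitePi_eq_pi]
  have h : ∀ x : Sym2 V → Prop, Real.exp (∑ e, (fromEdgeSet {i | x i}).edgeSet.indicator w e)
      = ∏ e, (fun (e : Sym2 V) (b : Prop) =>
        if b ∧ ¬ e.IsDiag then Real.exp (w e) else 1) e (x e) := by
    intro x
    rw [Real.exp_sum]
    refine Finset.prod_congr rfl fun e _ => ?_
    by_cases h1 : x e <;> by_cases h2 : e.IsDiag <;> simp [h1, h2]
  refine (integral_congr_ae (ae_of_all _ h)).trans ?_
  refine (integral_fintype_prod_eq_prod (μ := fun i : Sym2 V =>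
    unitInterval.toNNReal p • Measure.dirac (i ∈ Sym2.diagSetᶜ) +
      unitInterval.toNNReal (unitInterval.symm p) • Measure.dirac False)
    (fun (e : Sym2 V) (b : Prop) => if b ∧ ¬ e.IsDiag then Real.exp (w e) else 1)).trans ?_
  refine Finset.prod_congr rfl fun e _ => ?_
  rw [integral_add_measure Integrable.of_finite Integrable.of_finite]
  by_cases h2 : e.IsDiag <;> simp [h2, NNReal.smul_def]
  ring

-- Combines `exp w ≤ 1 + w + w²` for `|w| ≤ 1` with `1 + x ≤ exp x`.
open scoped Classical in
lemma integral_exp_sum_edgeWeight_le (p : unitInterval) {w : Sym2 V → ℝ} (hw : ∀ e, |w e| ≤ 1) :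
    ∫ G, Real.exp (∑ e, G.edgeSet.indicator w e) ∂(binomialRandom V p) ≤
      Real.exp (p * ∑ e : Sym2 V with ¬ e.IsDiag, (w e + w e ^ 2)) := by
  rw [integral_exp_sum_edgeWeight, Finset.mul_sum, Real.exp_sum, Finset.prod_filter]
  refine Finset.prod_le_prod (fun e _ => ?_) (fun e _ => ?_)
  · split_ifs
    · exact zero_le_one
    · have h1 := p.2.1
      have h2 := p.2.2
      have := Real.exp_pos (w e)
      have : 0 ≤ 1 - (p : ℝ) := by linarith
      positivity
  · by_cases h : e.IsDiag
    · simp [h]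
    · simp only [h, if_false, not_false_eq_true, if_true]
      have h1 := (abs_le.1 (Real.abs_exp_sub_one_sub_id_le (hw e))).2
      have h2 := mul_le_mul_of_nonneg_left h1 p.2.1
      have h3 := Real.add_one_le_exp (p * (w e + w e ^ 2))
      linarith

lemma edgeCount_eq_sum_pairMult (G : SimpleGraph V) (A B : Finset V) :
    edgeCount G A B = ∑ e, G.edgeSet.indicator (pairMult A B) e := by
  classical
  rw [edgeCount, ← Finset.sum_fiberwise _ (fun z : V × V => s(z.1, z.2))]
  refine Finset.sum_congr rfl fun e _ => ?_
  have h : ∀ z ∈ (A ×ˢ B).filter (fun z => s(z.1, z.2) = e),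
      adjWeight G z = if e ∈ G.edgeSet then 1 else 0 := by
    intro z hz
    rw [← (Finset.mem_filter.1 hz).2]
    simp [adjWeight]
  rw [Finset.sum_congr rfl h, Finset.sum_const, nsmul_eq_mul, Set.indicator_apply, pairMult]
  simp

open scoped Classical in
lemma sum_pairMult_add (A B : Finset V) :
    ∑ e : Sym2 V with ¬ e.IsDiag, pairMult A B e + ((A ∩ B).card : ℝ) =
      (A.card : ℝ) * B.card := by
  have h1 : ∑ e : Sym2 V, pairMult A B e = (A.card : ℝ) * B.card := by
    simp only [pairMult]
    rw [← Nat.cast_sum, ← Finset.card_eq_sum_card_fiberwise (by simp), Finset.card_product,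
      Nat.cast_mul]
  have h2 : ∑ e : Sym2 V with e.IsDiag, pairMult A B e = ((A ∩ B).card : ℝ) := by
    simp only [pairMult]
    rw [← Nat.cast_sum]
    congr 1
    have : (A ∩ B).card = ((A ×ˢ B).filter fun z => z.1 = z.2).card := by
      refine Finset.card_bij (fun x _ => (x, x)) ?_ ?_ ?_
      · intro x hx; simpa using hx
      · intro x _ y _ h; simpa using h
      · rintro ⟨x, y⟩ h
        simp only [Finset.mem_filter, Finset.mem_product] at h
        obtain ⟨⟨h1, h2⟩, rfl⟩ := h
        exact ⟨x, Finset.mem_inter.2 ⟨h1, h2⟩, rfl⟩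
    rw [this, Finset.card_eq_sum_card_fiberwise (f := fun z : V × V => s(z.1, z.2))
      (t := Finset.univ.filter fun e : Sym2 V => e.IsDiag)]
    · refine Finset.sum_congr rfl fun e he => ?_
      congr 1
      ext z
      simp only [Finset.mem_filter, Finset.mem_univ, true_and] at he ⊢
      constructor
      · rintro ⟨h1, rfl⟩
        exact ⟨⟨h1, by simpa using he⟩, rfl⟩
      · rintro ⟨h1, h2⟩
        exact ⟨h1.1, h2⟩
    · intro z hz
      simpa using (Finset.mem_filter.1 hz).2
  rw [← h1, ← h2, add_comm]
  exact Finset.sum_filter_add_sum_filter_not _ _ _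

/-- Exponential Markov inequality for the edge count. -/
lemma measure_edgeCount_tail_le (p : unitInterval) (A B : Finset V) {l : ℝ} (hl : |l| ≤ 1 / 2)
    (a : ℝ) :
    (binomialRandom V p).real {G | a ≤ l * edgeCount G A B} ≤
      Real.exp (-a + p * (l * (A.card * B.card - (A ∩ B).card) +
        2 * l ^ 2 * (A.card * B.card))) := by
  classical
  -- The Chernoff parameter is carried by `l`, whose sign is free so that both tails are covered.
  have hm := measure_ge_le_exp_mul_mgf (μ := binomialRandom V p)
    (X := fun G => l * edgeCount G A B) (t := 1) a zero_le_one Integrable.of_finite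
  refine hm.trans ?_
  have hmgf : mgf (fun G => l * edgeCount G A B) (binomialRandom V p) 1 ≤
      Real.exp (p * ∑ e : Sym2 V with ¬ e.IsDiag,
        (l * pairMult A B e + (l * pairMult A B e) ^ 2)) := by
    refine le_trans (le_of_eq ?_) (integral_exp_sum_edgeWeight_le p (w := fun e =>
      l * pairMult A B e) fun e => ?_)
    · simp only [mgf, one_mul]
      congr 1
      funext G
      rw [edgeCount_eq_sum_pairMult, Finset.mul_sum]
      congr 1
      refine Finset.sum_congr rfl fun e _ => ?_
      simp [Set.indicator_apply]
    · rw [abs_mul, abs_of_nonneg (pairMult_nonneg A B e)]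
      nlinarith [pairMult_nonneg A B e, pairMult_le_two A B e, abs_nonneg l]
  refine (mul_le_mul_of_nonneg_left hmgf (Real.exp_pos _).le).trans ?_
  rw [← Real.exp_add, Real.exp_le_exp, neg_one_mul]
  refine add_le_add_right (mul_le_mul_of_nonneg_left ?_ p.2.1) _
  have hs := sum_pairMult_add A B
  have hle : ∑ e : Sym2 V with ¬ e.IsDiag, (l * pairMult A B e + (l * pairMult A B e) ^ 2) ≤
      ∑ e : Sym2 V with ¬ e.IsDiag, (l + 2 * l ^ 2) * pairMult A B e := by
    refine Finset.sum_le_sum fun e _ => ?_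
    have h1 := mul_le_mul_of_nonneg_left (pairMult_le_two A B e) (pairMult_nonneg A B e)
    nlinarith [mul_le_mul_of_nonneg_left h1 (sq_nonneg l)]
  refine hle.trans ?_
  rw [← Finset.mul_sum]
  have hi : (0 : ℝ) ≤ (A ∩ B).card := Nat.cast_nonneg _
  have := mul_nonneg (sq_nonneg l) hi
  rw [← hs]
  linarith

/-- The edge counts of `Γ` between a set of at least `δ q |V|` vertices and any other set are
those of a random graph of density `q`, up to a relative error `δ`. -/
def EdgeUniform {V : Type*} [Fintype V] (δ q : ℝ) (Γ : SimpleGraph V) : Prop :=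
  ∀ A B : Finset V, δ * (q * Fintype.card V) ≤ A.card →
    |edgeCount Γ A B - q * (A.card * B.card)| ≤ δ * (q * Fintype.card V) * A.card

/-- Take `l = ±δ/8`. In units of `δ² p N |A| / 32`, the deviation contributes `-4` to the exponent
and the quadratic term at most `1`. In the lower tail the missing diagonal pairs add at most `2`,
because `2 ≤ δ N`. This leaves `-1`. -/
lemma measure_edgeCount_deviation_le (p : unitInterval) (A B : Finset V) {δ : ℝ} (hδ : 0 < δ)
    (hδ1 : δ ≤ 1) (hn : 2 ≤ δ * Fintype.card V) :
    (binomialRandom V p).real {G | δ * (p * Fintype.card V) * A.card <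
        |edgeCount G A B - p * (A.card * B.card)|} ≤
      2 * Real.exp (-(δ ^ 2 / 32 * (p * Fintype.card V) * A.card)) := by
  set N : ℝ := (Fintype.card V : ℝ) with hN
  set a : ℝ := (A.card : ℝ) with ha
  set b : ℝ := (B.card : ℝ) with hb
  have ha0 : 0 ≤ a := Nat.cast_nonneg _
  have hb0 : 0 ≤ b := Nat.cast_nonneg _
  have hp0 : (0 : ℝ) ≤ p := p.2.1
  have hbN : b ≤ N := by rw [hb, hN]; exact_mod_cast Finset.card_le_univ B
  have hi0 : (0 : ℝ) ≤ (A ∩ B).card := Nat.cast_nonneg _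
  have hia : ((A ∩ B).card : ℝ) ≤ a := by
    rw [ha]; exact_mod_cast Finset.card_le_card Finset.inter_subset_left
  have hab : a * b ≤ a * N := by gcongr
  have hpab : p * (a * b) ≤ p * (a * N) := by gcongr
  have habs : |δ / 8| ≤ 1 / 2 := by rw [abs_of_pos (by positivity)]; linarith
  have habs' : |-(δ / 8)| ≤ 1 / 2 := by rwa [abs_neg]
  have hu := measure_edgeCount_tail_le p A B habs (δ / 8 * (p * (a * b) + δ * (p * N) * a))
  have hl := measure_edgeCount_tail_le p A B habs' (-(δ / 8) * (p * (a * b) - δ * (p * N) * a))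
  have hsub : {G : SimpleGraph V | δ * (p * N) * a < |edgeCount G A B - p * (a * b)|} ⊆
      {G | δ / 8 * (p * (a * b) + δ * (p * N) * a) ≤ δ / 8 * edgeCount G A B} ∪
      {G | -(δ / 8) * (p * (a * b) - δ * (p * N) * a) ≤ -(δ / 8) * edgeCount G A B} := by
    intro G hG
    rw [Set.mem_ofPred_eq, lt_abs] at hG
    rcases hG with h | h
    · left
      rw [Set.mem_ofPred_eq]
      exact mul_le_mul_of_nonneg_left (by linarith) (by positivity)
    · right
      rw [Set.mem_ofPred_eq]
      exact mul_le_mul_of_nonpos_left (by linarith) (by linarith)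
  refine (measureReal_mono hsub).trans ((measureReal_union_le _ _).trans ?_)
  rw [two_mul]
  have hpa : 0 ≤ p * a := by positivity
  have hpia : p * ((A ∩ B).card : ℝ) ≤ p * a := by gcongr
  have hpi : 0 ≤ p * ((A ∩ B).card : ℝ) := by positivity
  have h2 : 2 * (p * a) ≤ δ * N * (p * a) := by gcongr
  refine add_le_add (hu.trans (Real.exp_le_exp.2 ?_)) (hl.trans (Real.exp_le_exp.2 ?_))
  · have e1 := mul_le_mul_of_nonneg_left hpab (sq_nonneg δ)
    have e2 := mul_nonneg hδ.le hpi
    have e3 : 0 ≤ δ ^ 2 * (p * (a * N)) := by positivity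
    nlinarith
  · have e1 := mul_le_mul_of_nonneg_left hpab (sq_nonneg δ)
    have e2 := mul_le_mul_of_nonneg_left hpia hδ.le
    have e3 := mul_le_mul_of_nonneg_left h2 hδ.le
    nlinarith

/-- Union bound over at most `4 ^ N` pairs of sets; the lower bound on `|A|` makes the exponent
quadratic in `p N`. -/
lemma measure_not_edgeUniform_le (p : unitInterval) {δ : ℝ} (hδ : 0 < δ)
    (hδ1 : δ ≤ 1) (hn : 2 ≤ δ * Fintype.card V) :
    (binomialRandom V p).real {G | ¬ G.EdgeUniform δ p} ≤
      4 ^ Fintype.card V * (2 * Real.exp (-(δ ^ 3 / 32 * (p * Fintype.card V) ^ 2))) := by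
  set N : ℝ := (Fintype.card V : ℝ) with hN
  have hp0 : (0 : ℝ) ≤ p := p.2.1
  set I : Finset (Finset V × Finset V) :=
    Finset.univ.filter fun z => δ * (p * N) ≤ z.1.card with hI
  have hsub : {G : SimpleGraph V | ¬ G.EdgeUniform δ p} ⊆ ⋃ z ∈ I,
      {G | δ * (p * N) * z.1.card < |edgeCount G z.1 z.2 - p * (z.1.card * z.2.card)|} := by
    intro G hG
    simp only [Set.mem_ofPred_eq, EdgeUniform, not_forall, not_le] at hG
    obtain ⟨A, B, hA, hAB⟩ := hG
    simp only [Set.mem_iUnion]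
    exact ⟨(A, B), by simpa [hI] using hA, hAB⟩
  refine (measureReal_mono hsub (measure_ne_top _ _)).trans
    ((measureReal_biUnion_finset_le _ _).trans ?_)
  calc _ ≤ ∑ z ∈ I, 2 * Real.exp (-(δ ^ 3 / 32 * (p * N) ^ 2)) := by
        refine Finset.sum_le_sum fun z hz => ?_
        refine (measure_edgeCount_deviation_le p z.1 z.2 hδ hδ1 hn).trans ?_
        have hz' := (Finset.mem_filter.1 hz).2
        have : δ ^ 2 / 32 * (p * N) * (δ * (p * N)) ≤ δ ^ 2 / 32 * (p * N) * z.1.card := by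
          gcongr
        refine mul_le_mul_of_nonneg_left (Real.exp_le_exp.2 ?_) two_pos.le
        nlinarith
    _ = I.card * (2 * Real.exp (-(δ ^ 3 / 32 * (p * N) ^ 2))) := by
        rw [Finset.sum_const, nsmul_eq_mul]
    _ ≤ _ := by
        refine mul_le_mul_of_nonneg_right ?_ (by positivity)
        have h1 : I.card ≤ 4 ^ Fintype.card V := by
          refine (Finset.card_le_univ I).trans (le_of_eq ?_)
          rw [Fintype.card_prod, Fintype.card_finset, ← mul_pow]
          norm_num
        exact_mod_cast h1

end RandomGraph

lemma eventually_le_sq_mul {p : ℕ → unitInterval}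
    (hp : (fun n : ℕ => (n : ℝ) ^ (-(1 / 2) : ℝ)) =o[atTop] (fun n : ℕ => (p n : ℝ)))
    {K : ℝ} (hK : 0 < K) : ∀ᶠ n : ℕ in atTop, K ≤ (p n : ℝ) ^ 2 * n := by
  have hc : 0 < (Real.sqrt K)⁻¹ := inv_pos.2 (Real.sqrt_pos.2 hK)
  filter_upwards [hp.bound hc, eventually_gt_atTop 0] with n hn hn0
  have hn0' : (0 : ℝ) < n := by exact_mod_cast hn0
  rw [Real.norm_of_nonneg (by positivity), Real.norm_of_nonneg (p n).2.1, Real.rpow_neg hn0'.le,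
    ← Real.sqrt_eq_rpow, ← div_eq_inv_mul, inv_eq_one_div,
    div_le_div_iff₀ (Real.sqrt_pos.2 hn0') (Real.sqrt_pos.2 hK), one_mul] at hn
  have h := mul_self_le_mul_self (Real.sqrt_nonneg K) hn
  rw [Real.mul_self_sqrt hK.le] at h
  calc K ≤ _ := h
    _ = (p n : ℝ) ^ 2 * (Real.sqrt n * Real.sqrt n) := by ring
    _ = _ := by rw [Real.mul_self_sqrt hn0'.le]

/-- The binomial random graph with `p` of larger order than `n ^ (-1 / 2)` is edge-uniform with
high probability. -/
theorem withHighProb_edgeUniform {p : ℕ → unitInterval}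
    (hp : (fun n : ℕ => (n : ℝ) ^ (-(1 / 2) : ℝ)) =o[atTop] (fun n : ℕ => (p n : ℝ)))
    {δ : ℝ} (hδ : 0 < δ) (hδ1 : δ ≤ 1) :
    WithHighProb p fun n Γ => Γ.EdgeUniform δ (p n) := by
  have hbad : Tendsto (fun n : ℕ => (binomialRandom (Fin n) (p n)).real
      {G | ¬ G.EdgeUniform δ (p n)}) atTop (𝓝 0) := by
    have hlim : Tendsto (fun n : ℕ => 2 * Real.exp (-(n : ℝ))) atTop (𝓝 0) := by
      have := (Real.tendsto_exp_neg_atTop_nhds_zero.comp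
        (tendsto_natCast_atTop_atTop (R := ℝ))).const_mul 2
      simpa using this
    refine squeeze_zero' (Eventually.of_forall fun n => by positivity) ?_ hlim
    -- With `K = 96 / δ³` the exponent is at least `3n`, which beats `4 ^ n ≤ exp (2n)`.
    filter_upwards [eventually_le_sq_mul hp (K := 96 / δ ^ 3) (by positivity),
      tendsto_natCast_atTop_atTop (R := ℝ) |>.eventually_ge_atTop (2 / δ)] with n h1 h2
    have h3 := measure_not_edgeUniform_le (V := Fin n) (p n) hδ hδ1 (by
      rw [Fintype.card_fin]
      rwa [div_le_iff₀' hδ] at h2)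
    rw [Fintype.card_fin] at h3
    refine h3.trans ?_
    have h4 : (3 : ℝ) * n ≤ δ ^ 3 / 32 * (p n * n) ^ 2 := by
      rw [div_le_iff₀ (by positivity)] at h1
      nlinarith [mul_le_mul_of_nonneg_right h1 (Nat.cast_nonneg (α := ℝ) n)]
    have h5 : (4 : ℝ) ^ n ≤ Real.exp (2 * n) := by
      rw [mul_comm, Real.exp_nat_mul]
      refine pow_le_pow_left₀ (by norm_num) ?_ n
      have := Real.add_one_le_exp (1 : ℝ)
      rw [show (2 : ℝ) = 1 + 1 by norm_num, Real.exp_add]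
      nlinarith
    calc _ ≤ Real.exp (2 * n) * (2 * Real.exp (-(3 * n))) := by gcongr
      _ = 2 * Real.exp (-(n : ℝ)) := by
        rw [mul_left_comm, ← Real.exp_add]; ring_nf
  have hgood : ∀ n : ℕ, binomialRandom (Fin n) (p n) {G | G.EdgeUniform δ (p n)} =
      ENNReal.ofReal (1 - (binomialRandom (Fin n) (p n)).real {G | ¬ G.EdgeUniform δ (p n)}) := by
    intro n
    have h := MeasureTheory.probReal_compl_eq_one_sub (μ := binomialRandom (Fin n) (p n))
      (s := {G | ¬ G.EdgeUniform δ (p n)}) (Set.toFinite _).measurableSet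
    rw [← h, MeasureTheory.ofReal_measureReal]
    congr 1
    ext G
    simp
  rw [WithHighProb]
  simp only [hgood]
  have := ENNReal.tendsto_ofReal (hbad.const_sub 1)
  simpa using this

lemma WithHighProb.mono {p : ℕ → unitInterval} {P Q : ∀ n : ℕ, SimpleGraph (Fin n) → Prop}
    (hP : WithHighProb p P) (h : ∀ᶠ n in atTop, ∀ Γ, P n Γ → Q n Γ) : WithHighProb p Q := by
  refine tendsto_of_tendsto_of_tendsto_of_le_of_le' hP tendsto_const_nhds ?_
    (Eventually.of_forall fun n => MeasureTheory.prob_le_one)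
  filter_upwards [h] with n hn
  exact MeasureTheory.measure_mono fun Γ hΓ => hn Γ hΓ

/-! ### Second neighbourhoods in pentagon-free subgraphs -/

section Deterministic

variable {V : Type*}

lemma adjWeight_nonneg (G : SimpleGraph V) (z : V × V) : 0 ≤ adjWeight G z := by
  unfold adjWeight; split_ifs <;> norm_num

lemma adjWeight_le_one (G : SimpleGraph V) (z : V × V) : adjWeight G z ≤ 1 := by
  unfold adjWeight; split_ifs <;> norm_num

lemma adjWeight_mono {G Γ : SimpleGraph V} (h : G ≤ Γ) (z : V × V) :
    adjWeight G z ≤ adjWeight Γ z := by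
  unfold adjWeight
  split_ifs with h1 h2
  · exact le_rfl
  · exact absurd (h h1) h2
  · exact zero_le_one
  · exact le_rfl

lemma edgeCount_nonneg (G : SimpleGraph V) (A B : Finset V) : 0 ≤ edgeCount G A B :=
  Finset.sum_nonneg fun _ _ => adjWeight_nonneg G _

lemma edgeCount_le_mul (G : SimpleGraph V) (A B : Finset V) :
    edgeCount G A B ≤ A.card * B.card := by
  refine (Finset.sum_le_sum fun z _ => adjWeight_le_one G z).trans ?_
  simp

lemma edgeCount_mono {G Γ : SimpleGraph V} (h : G ≤ Γ) (A B : Finset V) :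
    edgeCount G A B ≤ edgeCount Γ A B :=
  Finset.sum_le_sum fun z _ => adjWeight_mono h z

lemma edgeCount_comm (G : SimpleGraph V) (A B : Finset V) :
    edgeCount G A B = edgeCount G B A := by
  classical
  rw [edgeCount, edgeCount, Finset.sum_product, Finset.sum_product_right]
  refine Finset.sum_congr rfl fun x _ => Finset.sum_congr rfl fun y _ => ?_
  exact if_congr (G.adj_comm x y) rfl rfl

lemma edgeCount_eq_zero {G : SimpleGraph V} {A B : Finset V}
    (h : ∀ x ∈ A, ∀ y ∈ B, ¬ G.Adj x y) : edgeCount G A B = 0 := by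
  refine Finset.sum_eq_zero fun z hz => ?_
  rw [Finset.mem_product] at hz
  simp [adjWeight, h z.1 hz.1 z.2 hz.2]

/-- A closed walk through five distinct vertices is a copy of the cycle of length five. -/
lemma not_cycleGraph_five_free {G : SimpleGraph V} {a b c d e : V} (hab : G.Adj a b)
    (hbc : G.Adj b c) (hcd : G.Adj c d) (hde : G.Adj d e) (hea : G.Adj e a) (hac : a ≠ c)
    (had : a ≠ d) (hbd : b ≠ d) (hbe : b ≠ e) (hce : c ≠ e) : ¬ (cycleGraph 5).Free G := by
  intro h
  refine h ⟨⟨⟨![a, b, c, d, e], ?_⟩, ?_⟩⟩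
  · intro i j hij
    rw [cycleGraph_adj'] at hij
    fin_cases i <;> fin_cases j <;> first
      | exact absurd hij (by decide)
      | assumption
      | (apply Adj.symm; assumption)
  · have := hab.ne
    have := hbc.ne
    have := hcd.ne
    have := hde.ne
    have := hea.ne
    intro i j hij
    fin_cases i <;> fin_cases j <;> first
      | rfl
      | (exfalso; simp at hij; grind)

lemma edgeCount_union_right [DecidableEq V] (G : SimpleGraph V) (A : Finset V) {B C : Finset V}
    (h : Disjoint B C) : edgeCount G A (B ∪ C) = edgeCount G A B + edgeCount G A C := by
  rw [edgeCount, Finset.sum_product_right, Finset.sum_union h, ← Finset.sum_product_right,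
    ← Finset.sum_product_right]
  rfl

lemma edgeCount_union_left [DecidableEq V] (G : SimpleGraph V) {A B : Finset V} (C : Finset V)
    (h : Disjoint A B) : edgeCount G (A ∪ B) C = edgeCount G A C + edgeCount G B C := by
  rw [edgeCount_comm, edgeCount_union_right G C h, edgeCount_comm G C, edgeCount_comm G C]

variable [Fintype V]

/-- Removes the size condition on `A`: for small `A` both quantities lie between `0` and `δ q N²`.
-/
lemma EdgeUniform.abs_edgeCount_sub_le {Γ : SimpleGraph V} {δ q : ℝ} (hδ : 0 ≤ δ) (hq : 0 ≤ q)
    (hq1 : q ≤ 1) (hΓ : Γ.EdgeUniform δ q) (A B : Finset V) :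
    |edgeCount Γ A B - q * (A.card * B.card)| ≤ δ * (q * Fintype.card V ^ 2) := by
  set N : ℝ := (Fintype.card V : ℝ) with hNdef
  have hN0 : 0 ≤ N := Nat.cast_nonneg _
  have hAN : (A.card : ℝ) ≤ N := by rw [hNdef]; exact_mod_cast Finset.card_le_univ A
  have hBN : (B.card : ℝ) ≤ N := by rw [hNdef]; exact_mod_cast Finset.card_le_univ B
  rcases le_total (δ * (q * N)) A.card with h | h
  · calc _ ≤ δ * (q * N) * A.card := hΓ A B h
      _ ≤ δ * (q * N) * N := by gcongr
      _ = _ := by ring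
  · have h1 : (A.card * B.card : ℝ) ≤ δ * (q * N) * N := by gcongr
    have h2 := edgeCount_nonneg Γ A B
    have h3 := edgeCount_le_mul Γ A B
    have h4 : (0 : ℝ) ≤ A.card * B.card := by positivity
    have h5 : q * (A.card * B.card) ≤ 1 * (A.card * B.card : ℝ) := by gcongr
    have h6 : 0 ≤ q * (A.card * B.card) := by positivity
    rw [abs_le]
    constructor <;> nlinarith

open scoped Classical in
lemma edgeCount_univ (G : SimpleGraph V) (A : Finset V) :
    edgeCount G A Finset.univ = ∑ x ∈ A, (G.degree x : ℝ) := by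
  rw [edgeCount, Finset.sum_product]
  refine Finset.sum_congr rfl fun x _ => ?_
  simp only [adjWeight]
  rw [Finset.sum_boole, ← card_neighborFinset_eq_degree, neighborFinset_eq_filter]

open scoped Classical in
lemma le_edgeCount_univ (G : SimpleGraph V) {m : ℝ} (h : m ≤ G.minDegree) (A : Finset V) :
    m * A.card ≤ edgeCount G A Finset.univ := by
  rw [edgeCount_univ, mul_comm, ← nsmul_eq_mul]
  refine Finset.card_nsmul_le_sum _ _ _ fun x _ => h.trans ?_
  exact_mod_cast G.minDegree_le_degree x

variable [DecidableEq V]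

open scoped Classical in
/-- The vertices other than `v` having at least three common neighbours with `v`. -/
noncomputable def sndNbhd (G : SimpleGraph V) (v : V) : Finset V :=
  {w | w ≠ v ∧ 3 ≤ (({a | G.Adj v a ∧ G.Adj w a} : Finset V)).card}

/-- The threshold three leaves a common neighbour avoiding any two prescribed vertices, which keeps
the five-cycles below non-degenerate. -/
lemma exists_common_neighbor {G : SimpleGraph V} {v w : V} (h : w ∈ sndNbhd G v) (x y : V) :
    ∃ a, G.Adj v a ∧ G.Adj w a ∧ a ≠ x ∧ a ≠ y := by
  classical
  have h3 := (Finset.mem_filter.1 h).2.2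
  obtain ⟨a, ha, hne⟩ := Finset.exists_mem_notMem_of_card_lt_card
    (lt_of_le_of_lt (Finset.card_le_two (a := x) (b := y)) h3)
  simp only [Finset.mem_filter, Finset.mem_univ, true_and] at ha
  simp only [Finset.mem_insert, Finset.mem_singleton, not_or] at hne
  exact ⟨a, ha.1, ha.2, hne.1, hne.2⟩

lemma ne_of_mem_sndNbhd {G : SimpleGraph V} {v w : V} (h : w ∈ sndNbhd G v) : w ≠ v :=
  (Finset.mem_filter.1 h).2.1

/-- A common element `w` closes the pentagon `u a w b v`. -/
lemma disjoint_sndNbhd {G : SimpleGraph V} (hG : (cycleGraph 5).Free G) {u v : V}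
    (huv : G.Adj u v) : Disjoint (sndNbhd G u) (sndNbhd G v) := by
  rw [Finset.disjoint_left]
  intro w hu hv
  obtain ⟨a, ha1, ha2, ha3, -⟩ := exists_common_neighbor hu v v
  obtain ⟨b, hb1, hb2, hb3, hb4⟩ := exists_common_neighbor hv u a
  exact not_cycleGraph_five_free ha1 ha2.symm hb2 hb1.symm huv.symm (ne_of_mem_sndNbhd hu).symm
    hb3.symm hb4.symm ha3 (ne_of_mem_sndNbhd hv) hG

/-- An edge `x y` closes the pentagon `v a x y b`. -/
lemma not_adj_of_mem_sndNbhd {G : SimpleGraph V} (hG : (cycleGraph 5).Free G) {v x y : V}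
    (hx : x ∈ sndNbhd G v) (hy : y ∈ sndNbhd G v) : ¬ G.Adj x y := by
  intro hxy
  obtain ⟨a, ha1, ha2, ha3, -⟩ := exists_common_neighbor hx y y
  obtain ⟨b, hb1, hb2, hb3, hb4⟩ := exists_common_neighbor hy x a
  exact not_cycleGraph_five_free ha1 ha2.symm hxy hb2 hb1.symm (ne_of_mem_sndNbhd hx).symm
    (ne_of_mem_sndNbhd hy).symm ha3 hb4.symm hb3.symm hG

open scoped Classical in
/-- Second neighbourhoods in a subgraph of large minimum degree of an edge-uniform graph are
large. -/
lemma le_card_sndNbhd {G Γ : SimpleGraph V} (hle : G ≤ Γ) {δ q d : ℝ} (hδ : 0 < δ) (hδd : δ ≤ d)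
    (hq : 0 < q) (hΓ : Γ.EdgeUniform δ q) (hdeg : d * (q * Fintype.card V) ≤ G.minDegree)
    (hN : 0 < Fintype.card V) (hlarge : 3 ≤ δ * d * (q ^ 2 * Fintype.card V)) (v : V) :
    (d - 2 * δ) * Fintype.card V ≤ (sndNbhd G v).card := by
  set N : ℝ := (Fintype.card V : ℝ) with hNdef
  have hN0 : 0 < N := by rw [hNdef]; exact_mod_cast hN
  have hd : 0 < d := hδ.trans_le hδd
  set A := G.neighborFinset v with hA
  have hAcard : d * (q * N) ≤ A.card := by
    rw [hA, card_neighborFinset_eq_degree]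
    refine hdeg.trans ?_
    exact_mod_cast G.minDegree_le_degree v
  have hA0 : (0 : ℝ) < A.card := lt_of_lt_of_le (by positivity) hAcard
  have h1 : d * (q * N) * A.card ≤ edgeCount G A Finset.univ := le_edgeCount_univ G hdeg A
  have h2 : edgeCount G A Finset.univ =
      edgeCount G A (sndNbhd G v) + edgeCount G A (sndNbhd G v)ᶜ := by
    rw [← edgeCount_union_right G A disjoint_compl_right, Finset.union_compl]
  -- Each outside vertex other than `v` sends at most two edges to `A`, and `v` itself at most `N`.
  have h3 : edgeCount G A (sndNbhd G v)ᶜ ≤ 3 * N := by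
    rw [edgeCount_comm, edgeCount, Finset.sum_product]
    have hb : ∀ w ∈ (sndNbhd G v)ᶜ, ∑ a ∈ A, adjWeight G (w, a) ≤ 2 + if w = v then N else 0 := by
      intro w hw
      have hs : ∑ a ∈ A, adjWeight G (w, a) =
          ((({a | G.Adj v a ∧ G.Adj w a} : Finset V)).card : ℝ) := by
        simp only [adjWeight]
        rw [Finset.sum_boole, hA, neighborFinset_eq_filter, Finset.filter_filter]
      rw [hs]
      split_ifs with hwv
      · have : ((({a | G.Adj v a ∧ G.Adj w a} : Finset V)).card : ℝ) ≤ N := by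
          rw [hNdef]; exact_mod_cast Finset.card_le_univ _
        linarith
      · simp only [sndNbhd, Finset.mem_compl, Finset.mem_filter, Finset.mem_univ, true_and,
          not_and, not_le] at hw
        have := Nat.le_of_lt_succ (hw hwv)
        rw [add_zero]
        exact_mod_cast this
    refine (Finset.sum_le_sum hb).trans ?_
    have hc : (((sndNbhd G v)ᶜ).card : ℝ) ≤ N := by
      rw [hNdef]; exact_mod_cast Finset.card_le_univ _
    rw [Finset.sum_add_distrib, Finset.sum_const, nsmul_eq_mul, Finset.sum_ite_eq']
    split_ifs <;> linarith
  have h4 : edgeCount G A (sndNbhd G v) ≤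
      q * (A.card * (sndNbhd G v).card) + δ * (q * N) * A.card := by
    have hu := (abs_le.1 (hΓ A (sndNbhd G v)
      ((mul_le_mul_of_nonneg_right hδd (by positivity)).trans hAcard))).2
    have := edgeCount_mono hle A (sndNbhd G v)
    linarith
  -- This is where `q² N` must be large. The loss `2δ` is one `δ` from here and one from uniformity.
  have h5 : 3 * N ≤ δ * (q * N) * A.card := by
    calc 3 * N ≤ δ * d * (q ^ 2 * N) * N := by gcongr
      _ = δ * (q * N) * (d * (q * N)) := by ring
      _ ≤ _ := by gcongr
  have h6 : (d - 2 * δ) * N * (q * A.card) ≤ (sndNbhd G v).card * (q * A.card) := by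
    nlinarith
  exact le_of_mul_le_mul_right h6 (by positivity)

open scoped Classical in
/-- In a subgraph of large minimum degree of an edge-uniform graph, two disjoint independent sets
of more than a third of the vertices each span many edges between them. -/
lemma le_edgeCount_of_indep {G Γ : SimpleGraph V} (hle : G ≤ Γ) {δ q d c : ℝ}
    (hq : 0 < q) (hq1 : q ≤ 1) (hΓ : Γ.EdgeUniform δ q)
    (hdeg : d * (q * Fintype.card V) ≤ G.minDegree) {A B : Finset V} (hAB : Disjoint A B)
    (hA : ∀ x ∈ A, ∀ y ∈ A, ¬ G.Adj x y) (hB : ∀ x ∈ B, ∀ y ∈ B, ¬ G.Adj x y)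
    (hAc : c * Fintype.card V ≤ A.card) (hBc : c * Fintype.card V ≤ B.card)
    (hc : 1 / 2 ≤ 2 * c) (hδ : δ ≤ 1 / 2) (hpos : 0 ≤ d + 2 * c - 1 - δ) :
    (d + 2 * c - 1 - δ) * c * (q * Fintype.card V ^ 2) ≤ edgeCount G A B := by
  set N : ℝ := (Fintype.card V : ℝ) with hNdef
  have hN0 : 0 ≤ N := Nat.cast_nonneg _
  set U := A ∪ B with hU
  have hUc : (U.card : ℝ) = A.card + B.card := by
    rw [hU, Finset.card_union_of_disjoint hAB, Nat.cast_add]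
  have hUcc : ((Uᶜ).card : ℝ) = N - U.card := by
    rw [Finset.card_compl, Nat.cast_sub (Finset.card_le_univ _)]
  have h1 : d * (q * N) * U.card ≤ edgeCount G U Finset.univ := le_edgeCount_univ G hdeg U
  have h2 : edgeCount G U Finset.univ = edgeCount G U U + edgeCount G U Uᶜ := by
    rw [← edgeCount_union_right G U disjoint_compl_right, Finset.union_compl]
  -- Ordered pairs count each edge between `A` and `B` twice.
  have h3 : edgeCount G U U = 2 * edgeCount G A B := by
    rw [hU, edgeCount_union_right G _ hAB, edgeCount_union_left G _ hAB,
      edgeCount_union_left G _ hAB, edgeCount_eq_zero hA, edgeCount_eq_zero hB,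
      edgeCount_comm G B A]
    ring
  have hUlow : 2 * c * N ≤ U.card := by rw [hUc]; linarith
  have hqN : 0 ≤ q * N := by positivity
  have h4 : edgeCount G U Uᶜ ≤ q * (U.card * (Uᶜ).card) + δ * (q * N) * U.card := by
    have hu := (abs_le.1 (hΓ U Uᶜ (by
      have : δ * (q * N) ≤ 1 / 2 * (1 * N) := by gcongr
      nlinarith))).2
    have := edgeCount_mono hle U Uᶜ
    linarith
  have h5 : q * (U.card * (Uᶜ).card) ≤ (1 - 2 * c) * (q * N) * U.card := by
    rw [hUcc]
    have : q * U.card * (N - U.card) ≤ q * U.card * ((1 - 2 * c) * N) := by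
      gcongr
      linarith
    linarith
  have h6 : (d + 2 * c - 1 - δ) * (q * N) * (2 * c * N) ≤
      (d + 2 * c - 1 - δ) * (q * N) * U.card := by gcongr
  nlinarith

end Deterministic
-- Colouring by approximate intersection sizes
section Coloring

variable {V : Type*} [Fintype V]

/-- The edge counts of a subgraph of an edge-uniform graph are approximated by those of a
combination of boundedly many rectangles. -/
lemma exists_edgeCount_approximation [DecidableEq V] {G Γ : SimpleGraph V} (hle : G ≤ Γ)
    {δ q ε : ℝ} {M : ℕ} (hδ : 0 < δ) (hq : 0 < q) (hq1 : q ≤ 1) (hε : 0 < ε)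
    (hN : 0 < Fintype.card V) (hM : 1 + δ + ε ^ 2 * M ^ 2 * δ < M * ε ^ 2)
    (hΓ : Γ.EdgeUniform δ q) :
    ∃ k ≤ M, ∃ S T : ℕ → Finset V, ∃ s : ℕ → ℝ, (∀ t < k, |s t| ≤ 1) ∧
      ∀ A B : Finset V, |edgeCount G A B - q * (ε * ∑ t ∈ Finset.range k,
        s t * (((A ∩ S t).card : ℝ) * (B ∩ T t).card))| ≤ ε * (q * Fintype.card V ^ 2) := by
  have hcard : ((Fintype.card (V × V) : ℕ) : ℝ) = (Fintype.card V : ℝ) ^ 2 := by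
    rw [Fintype.card_prod]; push_cast; ring
  -- The family of rectangles is closed under intersection, and the majorant is the adjacency of
  -- `Γ`.
  obtain ⟨k, hk, R, s, hR, hs, happ⟩ := exists_cut_approximation (f := adjWeight G)
    (g := adjWeight Γ) (F := {R | ∃ S T : Finset V, R = S ×ˢ T}) hq hε
    (by rw [Fintype.card_prod]; positivity) hM (adjWeight_nonneg G) (adjWeight_mono hle)
    (by
      rintro _ ⟨S, T, rfl⟩ _ ⟨S', T', rfl⟩
      exact ⟨S ∩ S', T ∩ T', Finset.product_inter_product⟩)
    ⟨Finset.univ, Finset.univ, Finset.univ_product_univ.symm⟩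
    (by
      rintro _ ⟨S, T, rfl⟩
      rw [hcard, Finset.card_product, Nat.cast_mul]
      exact hΓ.abs_edgeCount_sub_le hδ.le hq.le hq1 S T)
  choose! S T hST using hR
  refine ⟨k, hk, S, T, s, hs, fun A B => ?_⟩
  have h := happ (A ×ˢ B) ⟨A, B, rfl⟩
  rw [hcard] at h
  have hsum : ∑ t ∈ Finset.range k, s t * (((A ∩ S t).card : ℝ) * (B ∩ T t).card) =
      ∑ t ∈ Finset.range k, s t * (((A ×ˢ B) ∩ R t).card : ℝ) := by
    refine Finset.sum_congr rfl fun t ht => ?_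
    rw [hST t (Finset.mem_range.1 ht), Finset.product_inter_product, Finset.card_product,
      Nat.cast_mul]
  rw [hsum]
  exact h

lemma abs_sub_le_of_mul_div_eq {M N a b : ℕ} (hN : 0 < N) (h : M * a / N = M * b / N) :
    (M : ℝ) * |(a : ℝ) - b| ≤ N := by
  have h1 := Nat.div_add_mod (M * a) N
  have h2 := Nat.div_add_mod (M * b) N
  have h3 := Nat.mod_lt (M * a) hN
  have h4 := Nat.mod_lt (M * b) hN
  rw [h] at h1
  have h5 : M * a ≤ M * b + N := by omega
  have h6 : M * b ≤ M * a + N := by omega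
  have h5' : (M : ℝ) * a ≤ M * b + N := by exact_mod_cast h5
  have h6' : (M : ℝ) * b ≤ M * a + N := by exact_mod_cast h6
  rw [← Nat.abs_cast M, ← abs_mul, abs_le]
  constructor <;> linarith

/-- If adjacent vertices carry sets, every one of which spans no edge while adjacent ones span many
edges between them, the graph has bounded chromatic number. -/
lemma colorable_of_edgeCount {G Γ : SimpleGraph V} (hle : G ≤ Γ)
    {δ q ε : ℝ} {M : ℕ} (hδ : 0 < δ) (hq : 0 < q) (hq1 : q ≤ 1) (hε : 0 < ε)
    (hN : 0 < Fintype.card V) (hM : 1 + δ + ε ^ 2 * M ^ 2 * δ < M * ε ^ 2)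
    (hΓ : Γ.EdgeUniform δ q) (D : V → Finset V) (hD : ∀ v, edgeCount G (D v) (D v) = 0)
    (hadj : ∀ u v, G.Adj u v → 3 * ε * (q * Fintype.card V ^ 2) < edgeCount G (D u) (D v)) :
    G.Colorable ((M + 1) ^ M) := by
  classical
  obtain ⟨k, hk, S, T, s, hs, happ⟩ :=
    exists_edgeCount_approximation hle hδ hq hq1 hε hN hM hΓ
  set N : ℝ := (Fintype.card V : ℝ) with hNdef
  have hN0 : 0 < N := by rw [hNdef]; exact_mod_cast hN
  have hbound : ∀ (v : V) (t : ℕ), M * (D v ∩ S t).card / Fintype.card V < M + 1 := by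
    intro v t
    refine Nat.lt_succ_of_le (Nat.div_le_of_le_mul ?_)
    rw [mul_comm]
    exact Nat.mul_le_mul_right _ (Finset.card_le_univ _)
  -- Sizes are rounded down in units of `N / M`, giving values `0` to `M`; at most `M` coordinates
  -- are needed.
  let col : V → Fin M → Fin (M + 1) := fun v t => ⟨_, hbound v t⟩
  have hval : ∀ {u v : V}, G.Adj u v → col u ≠ col v := by
    intro u v huv hcol
    have hclose : ∀ t < k, (M : ℝ) * |((D u ∩ S t).card : ℝ) - (D v ∩ S t).card| ≤ N := by
      intro t ht
      refine abs_sub_le_of_mul_div_eq hN ?_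
      have := congrFun hcol ⟨t, by omega⟩
      exact congrArg Fin.val this
    have h1 := (abs_le.1 (happ (D u) (D v))).2
    have h2 := (abs_le.1 (happ (D v) (D v))).1
    rw [hD] at h2
    have hdiff : ∑ t ∈ Finset.range k, s t * (((D u ∩ S t).card : ℝ) * (D v ∩ T t).card) -
        ∑ t ∈ Finset.range k, s t * (((D v ∩ S t).card : ℝ) * (D v ∩ T t).card) ≤ N ^ 2 := by
      rw [← Finset.sum_sub_distrib]
      calc _ ≤ ∑ t ∈ Finset.range k, N ^ 2 / M := by
            refine Finset.sum_le_sum fun t ht => ?_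
            rw [Finset.mem_range] at ht
            have hM0 : (0 : ℝ) < M := by exact_mod_cast (by omega : 0 < M)
            have hT : ((D v ∩ T t).card : ℝ) ≤ N := by
              rw [hNdef]; exact_mod_cast Finset.card_le_univ _
            rw [← mul_sub, ← sub_mul]
            refine (le_abs_self _).trans ?_
            rw [abs_mul, abs_mul, Nat.abs_cast, le_div_iff₀ hM0]
            calc _ ≤ 1 * (|((D u ∩ S t).card : ℝ) - (D v ∩ S t).card| * N) * M := by
                  gcongr
                  exact hs t ht
              _ = (M * |((D u ∩ S t).card : ℝ) - (D v ∩ S t).card|) * N := by ring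
              _ ≤ N * N := by gcongr; exact hclose t ht
              _ = N ^ 2 := by ring
        _ = k * (N ^ 2 / M) := by simp
        _ ≤ M * (N ^ 2 / M) := by gcongr
        _ ≤ N ^ 2 := by
            rcases M.eq_zero_or_pos with rfl | h
            · simpa using sq_nonneg N
            · rw [mul_div_cancel₀]
              exact_mod_cast h.ne'
    -- Three errors of `ε q N²` add up: two from the approximation and one from rounding. This is
    -- the `3ε` in `hadj`.
    have h3 := mul_le_mul_of_nonneg_left (mul_le_mul_of_nonneg_left hdiff hε.le) hq.le
    have h4 := hadj u v huv
    nlinarith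
  have := (Coloring.mk col hval).colorable
  simpa using this

open scoped Classical in
/-- Pentagon-free subgraphs of edge-uniform graphs with minimum degree above a third of the
typical degree have bounded chromatic number. -/
theorem colorable_of_edgeUniform {G Γ : SimpleGraph V} (hle : G ≤ Γ)
    {η δ q : ℝ} {M : ℕ} (hη : 0 < η) (hδ : 0 < δ) (hδη : 10 * δ ≤ η) (hδ1 : δ ≤ 1 / 3)
    (hq : 0 < q) (hq1 : q ≤ 1) (hN : 0 < Fintype.card V)
    (hM : 1 + δ + (η / 6) ^ 2 * M ^ 2 * δ < M * (η / 6) ^ 2)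
    (hlarge : 9 ≤ δ * (q ^ 2 * Fintype.card V)) (hΓ : Γ.EdgeUniform δ q)
    (hG : (cycleGraph 5).Free G)
    (hdeg : (1 / 3 + η) * (q * Fintype.card V) ≤ G.minDegree) :
    G.Colorable ((M + 1) ^ M) := by
  have hN0 : (0 : ℝ) < Fintype.card V := by exact_mod_cast hN
  have hsize : ∀ v, (1 / 3 + η - 2 * δ) * Fintype.card V ≤ (sndNbhd G v).card :=
    le_card_sndNbhd hle hδ (by linarith) hq hΓ hdeg hN (by
      have : 0 ≤ δ * (q ^ 2 * Fintype.card V) := by positivity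
      nlinarith)
  refine colorable_of_edgeCount hle hδ hq hq1 (by positivity) hN hM hΓ (sndNbhd G)
    (fun v => edgeCount_eq_zero fun x hx y hy => not_adj_of_mem_sndNbhd hG hx hy)
    fun u v huv => ?_
  refine lt_of_lt_of_le ?_ (le_edgeCount_of_indep hle hq hq1 hΓ hdeg (disjoint_sndNbhd hG huv)
    (fun x hx y hy => not_adj_of_mem_sndNbhd hG hx hy)
    (fun x hx y hy => not_adj_of_mem_sndNbhd hG hx hy) (hsize u) (hsize v)
    (by linarith) (by linarith) (by linarith))
  refine mul_lt_mul_of_pos_right ?_ (by positivity)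
  -- The middle expression equals `3η - 5δ`, and `10δ ≤ η`.
  have h1 : 2 * η ≤ 1 / 3 + η + 2 * (1 / 3 + η - 2 * δ) - 1 - δ := by linarith
  have h2 : 1 / 3 ≤ 1 / 3 + η - 2 * δ := by linarith
  calc 3 * (η / 6) < 2 * η * (1 / 3) := by linarith
    _ ≤ _ := mul_le_mul h1 h2 (by norm_num) (by linarith)

end Coloring

end SimpleGraph

/-! ### Choice of constants -/

theorem proposition5p1 (p : ℕ → unitInterval)
    (hp_large : (fun n : ℕ => (n : ℝ) ^ (-(1 / 2) : ℝ)) =o[atTop] (fun n : ℕ => (p n : ℝ)))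
    (hp_small : (fun n : ℕ => (p n : ℝ)) =o[atTop] (fun _ : ℕ => (1 : ℝ))) :
    SimpleGraph.chromaticThreshold (SimpleGraph.cycleGraph 5) p ≤ ((1 / 3 : ℝ) : EReal) := by
  refine le_of_forall_gt_imp_ge_of_dense fun b hb => ?_
  obtain ⟨d, hd, hdb⟩ := EReal.lt_iff_exists_real_btwn.1 hb
  rw [EReal.coe_lt_coe_iff] at hd
  refine le_trans (sInf_le ⟨d, ⟨by linarith, ?_⟩, rfl⟩) hdb.le
  set η := d - 1 / 3 with hη
  have hη0 : 0 < η := by linarith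
  -- With `ε = η/6`, this gives `M ε² > 3`, while the choice of `δ` below gives `1 + δ + ε² M² δ ≤
  -- 2`, as the energy argument requires.
  obtain ⟨M, hM⟩ := exists_nat_gt (3 / (η / 6) ^ 2)
  rw [div_lt_iff₀ (by positivity)] at hM
  set δ := min (min (η / 10) (1 / 3)) (1 / ((η / 6) ^ 2 * M ^ 2 + 1)) with hδ
  have hδ0 : 0 < δ := by
    rw [hδ]
    refine lt_min (lt_min ?_ ?_) ?_ <;> positivity
  have hδη : δ ≤ η / 10 := (min_le_left _ _).trans (min_le_left _ _)
  have hδ1 : δ ≤ 1 / 3 := (min_le_left _ _).trans (min_le_right _ _)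
  have hδM : δ * ((η / 6) ^ 2 * M ^ 2 + 1) ≤ 1 := by
    rw [← le_div_iff₀ (by positivity)]
    exact min_le_right _ _
  refine ⟨(M + 1) ^ M, by positivity, ?_⟩
  refine (SimpleGraph.withHighProb_edgeUniform hp_large hδ0 (by linarith)).mono ?_
  filter_upwards [SimpleGraph.eventually_le_sq_mul hp_large (K := 9 / δ) (by positivity),
    eventually_gt_atTop 0] with n hn hn0 Γ hΓ G hle hG hdeg
  rw [div_le_iff₀' hδ0] at hn
  have hq : (0 : ℝ) < p n := by
    refine lt_of_le_of_ne (p n).2.1 fun h => ?_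
    rw [← h] at hn
    norm_num at hn
  refine SimpleGraph.Colorable.chromaticNumber_le ?_
  refine SimpleGraph.colorable_of_edgeUniform hle hη0 hδ0 (by linarith) hδ1 hq (p n).2.2
    (by simpa using hn0) (by nlinarith) (by simpa using hn) hΓ hG ?_
  rw [Fintype.card_fin, ← mul_assoc, hη, add_sub_cancel]
  exact hdeg
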